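/- Let $\vec G$ be a finite connected symmetric digraph with at least two vertices (symmetric: $uv$ is an arc if and only if $vu$ is), and let $c$ assign a positive integer $c_{uv}$ to every arc $uv$. A dicycle is a closed directed walk of positive length with no repeated vertex other than its first and last one (in particular $u\to v\to u$ is a dicycle for every arc $uv$ with $u\neq v$). Let $T$ assign a nonnegative integer $T_{uv}$ (a number of tokens) to every arc $uv$; for a dicycle $C$ write $|C|_T=\sum_{uv\in E(C)}T_{uv}$ and $|C|_c=\sum_{uv\in E(C)}c_{uv}$. Assume that $T$ is good, that is, $|C|_T>0$ for every dicycle $C$ and $T_{uv}+T_{vu}=1$ for every arc $uv$. Play the following game in discrete time $t=1,2,3,\dots$, starting with $T_{uv}$ tokens on each arc $uv$. A vertex is fireable at time $t$ if each of its in-arcs carries at least one token at time $t$. At each time all fireable vertices fire simultaneously; a vertex $u$ that fires at time $t$ removes one token from each of its in-arcs at time $t$, and places one token on each out-arc $uv$ at time $t+c_{uv}$, where it is available from time $t+c_{uv}$ on. Let $h(t)$ be the set of vertices that are fireable at time $t$. Then there are positive integers $p$ and $M$ such that $h(t+p)=h(t)$ for all $t\ge M$. Let $p_{(\vec G,c,T)}$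 be the smallest such $p$. There is a positive integer $m_{(\vec G,c,T)}$ such that, for every positive integer $M$ with $h(t+p_{(\vec G,c,T)})=h(t)$ for all $t\ge M$, every vertex is fireable at exactly $m_{(\vec G,c,T)}$ of the times $t$ in $[M,M+p_{(\vec G,c,T)})$. Moreover $$\frac{p_{(\vec G,c,T)}}{m_{(\vec G,c,T)}}=\max_{C}\frac{|C|_c}{|C|_T},$$ where the maximum is taken over all dicycles $C$ of $\vec G$ and is attained. -/

import Mathlib

namespace TokenGame

variable {V : Type*}

/-- A directed cycle `vert 0 → vert 1 → ⋯ → vert n → vert 0` without repeated vertices. The index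
`i + 1` is taken cyclically in `Fin (n + 1)`. Dicycles `u → v → u` of length two are included. -/
structure Dicycle (G : Digraph V) where
  n : ℕ
  vert : Fin (n + 1) → V
  vert_injective : Function.Injective vert
  adj : ∀ i, G.Adj (vert i) (vert (i + 1))

/-- The sum over the arcs of `C` of an arc function: the weight `|C|_c` for `w = c`,
the token count `|C|_T` for `w = T`. -/
def Dicycle.total {G : Digraph V} (C : Dicycle G) (w : V → V → ℕ) : ℕ :=
  ∑ i, w (C.vert i) (C.vert (i + 1))

/-- Good initial markings. Only the values of `T` on arcs matter. -/
def IsGood (G : Digraph V) (T : V → V → ℕ) : Prop :=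
  (∀ C : Dicycle G, 0 < C.total T) ∧ ∀ u v, G.Adj u v → T u v + T v u = 1

open Classical in
/-- The number of tokens on the arc `uv` at time `t`, before the firings at time `t`, when `h s` is
the set of vertices that fire at time `s ≥ 1`: the initial tokens, plus those placed by firings
of `u` at times `s` with `s + c u v ≤ t`, minus those removed by firings of `v` before `t`. -/
noncomputable def tokens (c T : V → V → ℕ) (h : ℕ → Set V) (t : ℕ) (u v : V) : ℤ :=
  (T u v : ℤ) + ((Finset.Ico 1 t).filter (fun s => u ∈ h s ∧ s + c u v ≤ t)).card
    - ((Finset.Ico 1 t).filter (fun s => v ∈ h s)).card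

/-- The vertices that are fireable at time `t`, i.e. all of whose in-arcs carry a token. -/
def fireable (G : Digraph V) (c T : V → V → ℕ) (h : ℕ → Set V) (t : ℕ) : Set V :=
  {v | ∀ u, G.Adj u v → 0 < tokens c T h t u v}

/-- The record of the game up to time `t`: `history G c T t s` is the set of vertices that fire at
time `s`, for `1 ≤ s ≤ t`, and is empty for the other `s`. At each time `1, 2, 3, …`
all fireable vertices fire simultaneously. -/
def history (G : Digraph V) (c T : V → V → ℕ) : ℕ → ℕ → Set V
  | 0 => fun _ => ∅
  | t + 1 => Function.update (history G c T t) (t + 1) (fireable G c T (history G c T t) (t + 1))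

/-- The set `h(t)` of vertices that are fireable, and fire, at time pulse `t ≥ 1`
(with `h(0) = ∅`). -/
def fired (G : Digraph V) (c T : V → V → ℕ) (t : ℕ) : Set V :=
  history G c T t t

theorem history_eq_fired (G : Digraph V) (c T : V → V → ℕ) {s t : ℕ} (hst : s ≤ t) :
    history G c T t s = fired G c T s := by
  induction t with
  | zero =>
    obtain rfl : s = 0 := by omega
    rfl
  | succ t ih =>
    rcases Nat.lt_or_ge t s with h | h
    · obtain rfl : s = t + 1 := by omega
      rfl
    · rw [← ih h, history, Function.update_of_ne (by omega)]

open Classical in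
theorem tokens_congr (c T : V → V → ℕ) {h h' : ℕ → Set V} {t : ℕ}
    (hh : ∀ s, 1 ≤ s → s < t → h s = h' s) (u v : V) :
    tokens c T h t u v = tokens c T h' t u v := by
  have h1 : (Finset.Ico 1 t).filter (fun s => u ∈ h s ∧ s + c u v ≤ t)
      = (Finset.Ico 1 t).filter (fun s => u ∈ h' s ∧ s + c u v ≤ t) :=
    Finset.filter_congr fun s hs => by
      rw [Finset.mem_Ico] at hs
      rw [hh s hs.1 hs.2]
  have h2 : (Finset.Ico 1 t).filter (fun s => v ∈ h s)
      = (Finset.Ico 1 t).filter (fun s => v ∈ h' s) :=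
    Finset.filter_congr fun s hs => by
      rw [Finset.mem_Ico] at hs
      rw [hh s hs.1 hs.2]
  unfold tokens
  rw [h1, h2]

/-- The defining equation of the synchronous game. -/
theorem fired_eq_fireable (G : Digraph V) (c T : V → V → ℕ) {t : ℕ} (ht : 1 ≤ t) :
    fired G c T t = fireable G c T (fired G c T) t := by
  obtain ⟨t, rfl⟩ : ∃ k, t = k + 1 := ⟨t - 1, by omega⟩
  have h1 : fired G c T (t + 1) = fireable G c T (history G c T t) (t + 1) := by
    simp [fired, history]
  rw [h1]
  ext v
  change (∀ u, _ → _) ↔ (∀ u, _ → _)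
  refine forall_congr' fun u => imp_congr_right fun _ => ?_
  rw [tokens_congr c T (fun s _ hs => history_eq_fired G c T (Nat.lt_succ_iff.mp hs)) u v]

/-- From time `M` on, the game repeats itself after every `p` time pulses. -/
def IsSteady (G : Digraph V) (c T : V → V → ℕ) (p M : ℕ) : Prop :=
  0 < p ∧ 0 < M ∧ ∀ t, M ≤ t → fired G c T (t + p) = fired G c T t

/-- `p` is the period of `(G, c, T)`: the smallest `p` for which a steady state exists. -/
def IsPeriod (G : Digraph V) (c T : V → V → ℕ) (p : ℕ) : Prop :=
  IsLeast {p | ∃ M, IsSteady G c T p M} p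

open Classical in
/-- The number of times that the vertex `u` is fireable during the time interval `[M, M + p)`. -/
noncomputable def fireCount (G : Digraph V) (c T : V → V → ℕ) (p M : ℕ) (u : V) : ℕ :=
  ((Finset.Ico M (M + p)).filter (fun t => u ∈ fired G c T t)).card

/-- `m` is the multiplicity of `(G, c, T)`, where `p` is its period: every vertex is fireable exactly
`m` times during each interval `[M, M + p)` in the steady state. -/
def IsMultiplicity (G : Digraph V) (c T : V → V → ℕ) (p m : ℕ) : Prop :=
  ∀ M, IsSteady G c T p M → ∀ u, fireCount G c T p M u = m

end TokenGame

/-!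
Let `N v t` be the number of firings of `v` before time `t`. When every arc lies on a dicycle with a
single token, the rule of the game is the min-plus linear recursion
`N v (t + 1) = min_{u → v} (T u v + N u (t + 1 - c u v))`, and the game has finitely many
configurations, so it is eventually periodic: `N v (t + p) = N v t + m` for large `t`, with the same
`m` for all `v` because `N u t` and `N v t` differ by at most one if `u` and `v` are adjacent.
Then `p * N v t - m * t` is periodic in `t`, and its minimum `A v` over large `t` satisfies
`A v = min_{u → v} (A u + (p * T u v - m * c u v))`. Summing this around a dicycle `C` gives
`m * |C|_c ≤ p * |C|_T`, with equality if `C` uses only arcs at which the minimum is attained; such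
a dicycle exists because every vertex has an in-arc of this kind.
-/

namespace TokenGame

theorem exists_eventually_periodic {α : Type*} [Finite α] (f : ℕ → α)
    (hf : ∀ a b, f a = f b → f (a + 1) = f (b + 1)) :
    ∃ p M, 0 < p ∧ ∀ t, M ≤ t → f (t + p) = f t := by
  obtain ⟨a, b, hab, hfab⟩ : ∃ a b, a < b ∧ f a = f b := by
    obtain ⟨a, b, hne, h⟩ := Finite.exists_ne_map_eq_of_infinite f
    rcases hne.lt_or_gt with hlt | hlt
    exacts [⟨a, b, hlt, h⟩, ⟨b, a, hlt, h.symm⟩]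
  refine ⟨b - a, a, by omega, fun t ht => ?_⟩
  induction t, ht using Nat.le_induction with
  | base => rw [Nat.add_sub_cancel' hab.le, hfab]
  | succ t _ ih => rw [Nat.add_right_comm, hf _ _ ih]

theorem exists_forall_le_of_eventually_periodic {α : Type*} [LinearOrder α] {f : ℕ → α} {p M : ℕ}
    (hp : 0 < p) (hf : ∀ t, M ≤ t → f (t + p) = f t) (N : ℕ) :
    ∃ s, N ≤ s ∧ ∀ t, M ≤ t → f s ≤ f t := by
  have hper : Function.Periodic (fun k => f (M + k)) p := fun k => by
    simpa only [Nat.add_assoc] using hf (M + k) (Nat.le_add_right M k)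
  obtain ⟨i, -, hi⟩ := (Finset.range p).exists_min_image (fun k => f (M + k)) ⟨0, by simpa⟩
  refine ⟨M + (i + N * p), by have := Nat.le_mul_of_pos_right N hp; omega, fun t ht => ?_⟩
  calc f (M + (i + N * p)) = f (M + i) := hper.nat_mul N i
    _ ≤ f (M + (t - M) % p) := hi _ (Finset.mem_range.2 (Nat.mod_lt _ hp))
    _ = f (M + (t - M)) := hper.map_mod_nat (t - M)
    _ = f t := by rw [Nat.add_sub_cancel' ht]

theorem le_of_forall_add_mul_le {a b x y : ℕ} (h : ∀ k, a + k * x ≤ b + k * y) : x ≤ y := by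
  by_contra! hlt
  have hmul : (b + 1) * (y + 1) ≤ (b + 1) * x := Nat.mul_le_mul_left _ hlt
  have := h (b + 1)
  linarith

theorem exists_forall_arc_le {V : Type*} [Finite V] (w : V → V → ℕ) : ∃ K, ∀ u v, w u v ≤ K := by
  obtain ⟨K, hK⟩ := (Set.finite_range fun e : V × V => w e.1 e.2).bddAbove
  exact ⟨K, fun u v => hK ⟨(u, v), rfl⟩⟩

namespace Dicycle

variable {V : Type*} {G : Digraph V}

theorem sum_vert_add_one {R : Type*} [AddCommMonoid R] (C : Dicycle G) (f : V → R) :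
    ∑ i, f (C.vert (i + 1)) = ∑ i, f (C.vert i) :=
  Equiv.sum_comp (Equiv.addRight 1) fun i => f (C.vert i)

theorem sum_add_sub (C : Dicycle G) (w : V → V → ℤ) (A : V → ℤ) :
    ∑ i, (A (C.vert i) + w (C.vert i) (C.vert (i + 1)) - A (C.vert (i + 1)))
      = ∑ i, w (C.vert i) (C.vert (i + 1)) := by
  rw [Finset.sum_sub_distrib, Finset.sum_add_distrib, C.sum_vert_add_one, add_sub_cancel_left]

theorem sum_mul_sub_mul (C : Dicycle G) (c T : V → V → ℕ) (p m : ℕ) :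
    ∑ i, ((p : ℤ) * T (C.vert i) (C.vert (i + 1)) - m * c (C.vert i) (C.vert (i + 1)))
      = p * C.total T - m * C.total c := by
  simp only [total, Finset.sum_sub_distrib, Finset.mul_sum, Nat.cast_sum]

theorem nonempty_of_forall_exists_adj [Finite V] [Nonempty V] (h : ∀ v, ∃ u, G.Adj u v) :
    Nonempty (Dicycle G) := by
  choose pred hpred using h
  obtain ⟨p, M, hp, hperiodic⟩ := exists_eventually_periodic
    (fun n => pred^[n] (Classical.arbitrary V))
    fun a b hab => by simp only [Function.iterate_succ_apply', hab]
  set x := pred^[M] (Classical.arbitrary V) with hx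
  have hxp : Function.IsPeriodicPt pred p x := by
    rw [Function.IsPeriodicPt, Function.IsFixedPt, hx, ← Function.iterate_add_apply, Nat.add_comm]
    exact hperiodic M le_rfl
  obtain ⟨n, hn⟩ := Nat.exists_eq_add_one.2 (hxp.minimalPeriod_pos hp)
  refine ⟨⟨n, fun i => pred^[n - i] x, fun i j hij => ?_, fun i => ?_⟩⟩
  · have := Function.iterate_injOn_Iio_minimalPeriod
      (show n - (i : ℕ) < _ by omega) (show n - (j : ℕ) < _ by omega) hij
    omega
  · suffices pred^[n - i] x = pred (pred^[n - (i + 1 : Fin (n + 1))] x) from this ▸ hpred _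
    rw [← Function.iterate_succ_apply' pred]
    rcases eq_or_ne i (Fin.last n) with rfl | hi
    · simp [← hn, Function.iterate_minimalPeriod]
    · have hlt := Fin.lt_last_iff_ne_last.2 hi
      rw [Fin.val_add_one_of_lt hlt]
      congr 2
      have : (i : ℕ) < n := hlt
      omega

theorem mul_total_le {c T : V → V → ℕ} {p m : ℕ} {A : V → ℤ}
    (hA : ∀ u v, G.Adj u v → A v ≤ A u + (p * T u v - m * c u v)) (C : Dicycle G) :
    m * C.total c ≤ p * C.total T := by
  have hnonneg := Finset.sum_nonneg fun i (_ : i ∈ Finset.univ) =>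
    sub_nonneg.2 (hA _ _ (C.adj i))
  rw [C.sum_add_sub fun u v => p * T u v - m * c u v, C.sum_mul_sub_mul] at hnonneg
  zify
  linarith

theorem exists_mul_total_eq [Finite V] [Nonempty V] {c T : V → V → ℕ} {p m : ℕ} {A : V → ℤ}
    (hA : ∀ v, ∃ u, G.Adj u v ∧ A v = A u + (p * T u v - m * c u v)) :
    ∃ C : Dicycle G, m * C.total c = p * C.total T := by
  let tight : Digraph V := ⟨fun u v => G.Adj u v ∧ A v = A u + (p * T u v - m * c u v)⟩
  obtain ⟨D⟩ := nonempty_of_forall_exists_adj (G := tight) hA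
  let C : Dicycle G := ⟨D.n, D.vert, D.vert_injective, fun i => (D.adj i).1⟩
  have hzero := Finset.sum_eq_zero fun i (_ : i ∈ Finset.univ) =>
    sub_eq_zero.2 (D.adj i).2.symm
  rw [C.sum_add_sub fun u v => p * T u v - m * c u v, C.sum_mul_sub_mul] at hzero
  refine ⟨C, ?_⟩
  zify
  linarith

end Dicycle

section Firings

variable {V : Type*}

open Classical in
/-- The number of times at which `v` fires before time `t`. As no vertex fires at time `0`, counting
from `0` rather than from `1` is harmless. -/
noncomputable def firings (G : Digraph V) (c T : V → V → ℕ) (v : V) (t : ℕ) : ℕ :=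
  Nat.count (fun s => v ∈ fired G c T s) t

variable (G : Digraph V) (c T : V → V → ℕ)

theorem notMem_fired_zero (v : V) : v ∉ fired G c T 0 :=
  Set.notMem_empty v

@[simp]
theorem firings_zero (v : V) : firings G c T v 0 = 0 := by
  classical exact Nat.count_zero _

open Classical in
theorem firings_succ (v : V) (t : ℕ) :
    firings G c T v (t + 1) = firings G c T v t + if v ∈ fired G c T t then 1 else 0 :=
  Nat.count_succ _ t

theorem firings_mono (v : V) : Monotone (firings G c T v) := by
  classical exact Nat.count_monotone _

theorem firings_add_fireCount (p M : ℕ) (v : V) :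
    firings G c T v (M + p) = firings G c T v M + fireCount G c T p M v := by
  classical
  simp only [firings, fireCount, Nat.count_eq_card_filter_range, Finset.card_filter]
  exact (Finset.sum_range_add_sum_Ico _ (Nat.le_add_right M p)).symm

theorem tokens_fired {u v : V} (hc : 0 < c u v) (t : ℕ) :
    tokens c T (fired G c T) t u v
      = T u v + firings G c T u (t + 1 - c u v) - firings G c T v t := by
  classical
  have hpos {v : V} {s : ℕ} (hs : v ∈ fired G c T s) : 1 ≤ s :=
    Nat.one_le_iff_ne_zero.2 fun h => notMem_fired_zero G c T v (h ▸ hs)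
  simp only [tokens, firings, Nat.count_eq_card_filter_range]
  congr 3
  · congr 1
    ext s
    simp only [Finset.mem_filter, Finset.mem_Ico, Finset.mem_range]
    constructor
    · rintro ⟨-, hs, hle⟩
      exact ⟨by omega, hs⟩
    · rintro ⟨hlt, hs⟩
      exact ⟨⟨hpos hs, by omega⟩, hs, by omega⟩
  · ext s
    simp only [Finset.mem_filter, Finset.mem_Ico, Finset.mem_range]
    exact ⟨fun ⟨hlt, hs⟩ => ⟨hlt.2, hs⟩, fun ⟨hlt, hs⟩ => ⟨⟨hpos hs, hlt⟩, hs⟩⟩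

open Classical in
theorem tokens_fired_succ {u v : V} (hc : 0 < c u v) (t : ℕ) :
    tokens c T (fired G c T) (t + 1) u v = tokens c T (fired G c T) t u v
      + (if u ∈ fired G c T (t + 1 - c u v) then 1 else 0)
      - (if v ∈ fired G c T t then 1 else 0) := by
  have harrive : firings G c T u (t + 1 + 1 - c u v) = firings G c T u (t + 1 - c u v)
      + if u ∈ fired G c T (t + 1 - c u v) then 1 else 0 := by
    rcases Nat.lt_or_ge (t + 1) (c u v) with hlt | hle
    · simp [show t + 1 + 1 - c u v = 0 by omega, show t + 1 - c u v = 0 by omega,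
        notMem_fired_zero]
    · rw [Nat.sub_add_comm hle, firings_succ]
  rw [tokens_fired G c T hc, tokens_fired G c T hc, harrive, firings_succ]
  push_cast
  ring

variable {G c T}

theorem mem_fired_iff (hc : ∀ u v, G.Adj u v → 0 < c u v) {v : V} {t : ℕ} (ht : 1 ≤ t) :
    v ∈ fired G c T t ↔
      ∀ u, G.Adj u v → firings G c T v t < T u v + firings G c T u (t + 1 - c u v) := by
  rw [fired_eq_fireable G c T ht]
  refine forall₂_congr fun u huv => ?_
  rw [tokens_fired G c T (hc u v huv)]
  omega

theorem firings_le (hc : ∀ u v, G.Adj u v → 0 < c u v) {u v : V} (huv : G.Adj u v) (t : ℕ) :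
    firings G c T v t ≤ T u v + firings G c T u (t - c u v) := by
  induction t with
  | zero => simp
  | succ t ih =>
    rw [firings_succ]
    split_ifs with h
    · have ht : 1 ≤ t := Nat.one_le_iff_ne_zero.2 fun h0 => notMem_fired_zero G c T v (h0 ▸ h)
      exact (mem_fired_iff hc ht).1 h u huv
    · exact ih.trans (Nat.add_le_add_left (firings_mono G c T u (by omega)) _)

theorem firings_le_add_firings (hc : ∀ u v, G.Adj u v → 0 < c u v) {u v : V} (huv : G.Adj u v)
    (t : ℕ) : firings G c T v t ≤ T u v + firings G c T u t :=
  (firings_le hc huv t).trans (Nat.add_le_add_left (firings_mono G c T u (Nat.sub_le _ _)) _)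

end Firings

section Safe

variable {V : Type*} {G : Digraph V} {c T : V → V → ℕ}

/-- Safe markings: every arc lies on a dicycle that carries a single token. Since the number of
tokens on a dicycle, including those in transit, never changes, no arc ever holds two tokens. -/
def IsSafe (G : Digraph V) (T : V → V → ℕ) : Prop :=
  ∀ u v, G.Adj u v → ∃ (C : Dicycle G) (i : Fin (C.n + 1)),
    C.vert i = u ∧ C.vert (i + 1) = v ∧ C.total T = 1

theorem isSafe_of_symm (hsymm : ∀ u v, G.Adj u v → G.Adj v u)
    (hT : ∀ u v, G.Adj u v → T u v + T v u = 1) : IsSafe G T := by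
  intro u v huv
  have hne : u ≠ v := by
    rintro rfl
    have := hT u u huv
    omega
  let C : Dicycle G :=
    { n := 1
      vert := ![u, v]
      vert_injective := by simp [Function.Injective, Fin.forall_fin_two, hne, hne.symm]
      adj := by simpa [Fin.forall_fin_two] using ⟨huv, hsymm u v huv⟩ }
  refine ⟨C, (0 : Fin 2), rfl, rfl, ?_⟩
  change ∑ i : Fin 2, T (![u, v] i) (![u, v] (i + 1)) = 1
  rw [Fin.sum_univ_two]
  exact hT u v huv

namespace IsSafe

theorem exists_adj [Nontrivial V] (hsafe : IsSafe G T)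
    (hconn : G.toSimpleGraphInclusive.Connected) (v : V) : ∃ u, G.Adj u v := by
  obtain ⟨u, -, huv | hvu⟩ := hconn.preconnected.exists_adj_of_nontrivial v
  · obtain ⟨C, i, rfl, -⟩ := hsafe v u huv
    exact ⟨_, by simpa using C.adj (i - 1)⟩
  · exact ⟨u, hvu⟩

theorem add_firings_le (hsafe : IsSafe G T) (hc : ∀ u v, G.Adj u v → 0 < c u v) {u v : V}
    (huv : G.Adj u v) (t : ℕ) : T u v + firings G c T u t ≤ firings G c T v t + 1 := by
  obtain ⟨C, i, rfl, rfl, hC⟩ := hsafe u v huv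
  let held (i : Fin (C.n + 1)) : ℤ := firings G c T (C.vert i) t + T (C.vert i) (C.vert (i + 1))
    - firings G c T (C.vert (i + 1)) t
  have hheld : ∀ j ∈ Finset.univ, 0 ≤ held j := fun j _ => by
    have := firings_le_add_firings (T := T) hc (C.adj j) t
    simp only [held]
    omega
  have hsum : ∑ j, held j = 1 := by
    rw [C.sum_add_sub (fun u v => T u v) fun v => firings G c T v t]
    exact_mod_cast hC
  have hle : held i ≤ 1 := hsum ▸ Finset.single_le_sum hheld (Finset.mem_univ i)
  simp only [held] at hle
  omega

theorem add_firings_sub_le (hsafe : IsSafe G T) (hc : ∀ u v, G.Adj u v → 0 < c u v) {u v : V}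
    (huv : G.Adj u v) (t : ℕ) :
    T u v + firings G c T u (t + 1 - c u v) ≤ firings G c T v t + 1 :=
  (Nat.add_le_add_left (firings_mono G c T u (by have := hc u v huv; omega)) _).trans
    (hsafe.add_firings_le hc huv t)

theorem exists_firings_succ_eq (hsafe : IsSafe G T) (hc : ∀ u v, G.Adj u v → 0 < c u v) {v : V}
    (hv : ∃ u, G.Adj u v) {t : ℕ} (ht : 1 ≤ t) :
    ∃ u, G.Adj u v ∧ firings G c T v (t + 1) = T u v + firings G c T u (t + 1 - c u v) := by
  by_cases h : v ∈ fired G c T t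
  · obtain ⟨u, huv⟩ := hv
    refine ⟨u, huv, (firings_le hc huv (t + 1)).antisymm ?_⟩
    rw [firings_succ, if_pos h]
    exact hsafe.add_firings_sub_le hc huv t
  · obtain ⟨u, huv, hle⟩ : ∃ u, G.Adj u v ∧
        T u v + firings G c T u (t + 1 - c u v) ≤ firings G c T v t := by
      simpa only [mem_fired_iff hc ht, not_forall, not_lt, exists_prop] using h
    refine ⟨u, huv, (firings_le hc huv (t + 1)).antisymm (hle.trans ?_)⟩
    exact firings_mono G c T v (Nat.le_succ t)

end IsSafe

/-- The configuration of the game at time `t`: the arcs that hold a token, and the sets of vertices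
fired during the last `K + 1` time pulses, which determine the tokens in transit if `K` bounds
`c`. -/
def config (G : Digraph V) (c T : V → V → ℕ) (K t : ℕ) :
    (V → V → Prop) × (Fin (K + 1) → Set V) :=
  (fun u v => G.Adj u v ∧ 0 < tokens c T (fired G c T) t u v, fun i => fired G c T (t - i))

theorem fired_eq_of_config_eq {K a b i : ℕ} (hab : config G c T K a = config G c T K b)
    (hi : i ≤ K) : fired G c T (a - i) = fired G c T (b - i) :=
  congrFun (congrArg Prod.snd hab) ⟨i, Nat.lt_succ_of_le hi⟩

theorem IsSafe.tokens_eq_of_config_eq (hsafe : IsSafe G T) (hc : ∀ u v, G.Adj u v → 0 < c u v)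
    {K a b : ℕ} (hab : config G c T K a = config G c T K b) {u v : V} (huv : G.Adj u v) :
    tokens c T (fired G c T) a u v = tokens c T (fired G c T) b u v := by
  have hzero_or_one (t : ℕ) : tokens c T (fired G c T) t u v = 0 ∨
      tokens c T (fired G c T) t u v = 1 := by
    have hle := hsafe.add_firings_sub_le hc huv t
    have hge := (firings_le (T := T) hc huv t).trans
      (Nat.add_le_add_left (firings_mono G c T u (show t - c u v ≤ t + 1 - c u v by omega)) _)
    rw [tokens_fired G c T (hc u v huv)]
    omega
  have hpos : 0 < tokens c T (fired G c T) a u v ↔ 0 < tokens c T (fired G c T) b u v := by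
    simpa [config, huv] using congrFun (congrFun (congrArg Prod.fst hab) u) v
  have := hzero_or_one a
  have := hzero_or_one b
  omega

theorem IsSafe.config_succ_eq (hsafe : IsSafe G T) (hc : ∀ u v, G.Adj u v → 0 < c u v)
    {K : ℕ} (hK : ∀ u v, c u v ≤ K) {a b : ℕ} (hab : config G c T K a = config G c T K b) :
    config G c T K (a + 1) = config G c T K (b + 1) := by
  have htokens : ∀ u v, G.Adj u v →
      tokens c T (fired G c T) (a + 1) u v = tokens c T (fired G c T) (b + 1) u v := by
    intro u v huv
    have hpos := hc u v huv
    have harrive : fired G c T (a + 1 - c u v) = fired G c T (b + 1 - c u v) := by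
      have := fired_eq_of_config_eq hab (i := c u v - 1) (by have := hK u v; omega)
      rwa [show a + 1 - c u v = a - (c u v - 1) by omega,
        show b + 1 - c u v = b - (c u v - 1) by omega]
    have hleave : fired G c T a = fired G c T b := fired_eq_of_config_eq hab K.zero_le
    rw [tokens_fired_succ G c T hpos, tokens_fired_succ G c T hpos, harrive, hleave,
      hsafe.tokens_eq_of_config_eq hc hab huv]
  refine Prod.ext (funext₂ fun u v => propext (and_congr_right fun huv => ?_)) (funext fun i => ?_)
  · rw [htokens u v huv]
  · obtain ⟨_ | i, hi⟩ := i
    · change fired G c T (a + 1) = fired G c T (b + 1)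
      rw [fired_eq_fireable G c T (by omega), fired_eq_fireable G c T (by omega)]
      exact Set.ext fun v => forall₂_congr fun u huv => by rw [htokens u v huv]
    · simpa only [config, Nat.add_sub_add_right] using fired_eq_of_config_eq hab (i := i) (by omega)

theorem IsSafe.exists_isPeriod [Finite V] (hsafe : IsSafe G T)
    (hc : ∀ u v, G.Adj u v → 0 < c u v) : ∃ p, IsPeriod G c T p := by
  obtain ⟨K, hK⟩ := exists_forall_arc_le c
  obtain ⟨p, M, hp, hper⟩ := exists_eventually_periodic (config G c T K)
    fun _ _ hab => hsafe.config_succ_eq hc hK hab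
  have hsteady : IsSteady G c T p (M + 1) := ⟨hp, M.succ_pos, fun t ht =>
    fired_eq_of_config_eq (hper t (by omega)) K.zero_le⟩
  exact ⟨_, Nat.sInf_mem (s := {p | ∃ M, IsSteady G c T p M}) ⟨p, M + 1, hsteady⟩,
    fun _ hq => Nat.sInf_le hq⟩

end Safe

section Deviation

variable {V : Type*} {G : Digraph V} {c T : V → V → ℕ}

/-- The deviation, scaled by `p`, of the number of firings of `v` before time `t` from that of a
vertex that fires at the constant rate `m / p`. -/
noncomputable def deviation (G : Digraph V) (c T : V → V → ℕ) (p m : ℕ) (v : V) (t : ℕ) : ℤ :=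
  p * firings G c T v t - m * t

theorem deviation_add_le (hc : ∀ u v, G.Adj u v → 0 < c u v) {p m : ℕ} {u v : V}
    (huv : G.Adj u v) (t : ℕ) :
    deviation G c T p m v (t + c u v) ≤ deviation G c T p m u t + (p * T u v - m * c u v) := by
  have hfirings := Nat.mul_le_mul_left p (firings_le (T := T) hc huv (t + c u v))
  rw [Nat.add_sub_cancel] at hfirings
  zify at hfirings
  rw [deviation, deviation]
  push_cast
  linarith

theorem IsSafe.exists_deviation_eq (hsafe : IsSafe G T) (hc : ∀ u v, G.Adj u v → 0 < c u v)
    {v : V} (hv : ∃ u, G.Adj u v) {t : ℕ} (hct : ∀ u, c u v ≤ t) (ht : 2 ≤ t) (p m : ℕ) :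
    ∃ u, G.Adj u v ∧ deviation G c T p m v t
      = deviation G c T p m u (t - c u v) + (p * T u v - m * c u v) := by
  obtain ⟨t, rfl⟩ : ∃ s, t = s + 1 := Nat.exists_eq_add_one.2 (by omega)
  obtain ⟨u, huv, heq⟩ := hsafe.exists_firings_succ_eq hc hv (t := t) (by omega)
  refine ⟨u, huv, ?_⟩
  rw [deviation, deviation, heq, Nat.cast_sub (hct u)]
  push_cast
  ring

end Deviation

namespace IsSteady

variable {V : Type*} {G : Digraph V} {c T : V → V → ℕ} {p M : ℕ}

theorem firings_add (h : IsSteady G c T p M) (v : V) {t : ℕ} (ht : M ≤ t) :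
    firings G c T v (t + p) = firings G c T v t + fireCount G c T p M v := by
  induction t, ht using Nat.le_induction with
  | base => exact firings_add_fireCount G c T p M v
  | succ t ht ih =>
    rw [Nat.add_right_comm, firings_succ, firings_succ, ih, h.2.2 t ht, Nat.add_right_comm]

theorem firings_add_mul (h : IsSteady G c T p M) (v : V) (k : ℕ) :
    firings G c T v (M + k * p) = firings G c T v M + k * fireCount G c T p M v := by
  induction k with
  | zero => simp
  | succ k ih =>
    rw [Nat.succ_mul, Nat.succ_mul, ← Nat.add_assoc, h.firings_add v (Nat.le_add_right _ _), ih,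
      Nat.add_assoc]

theorem fireCount_eq_fireCount {M' : ℕ} (h : IsSteady G c T p M) (h' : IsSteady G c T p M')
    (v : V) : fireCount G c T p M v = fireCount G c T p M' v :=
  Nat.add_left_cancel ((h.firings_add v (le_max_left M M')).symm.trans
    (h'.firings_add v (le_max_right M M')))

theorem fireCount_le_fireCount (h : IsSteady G c T p M) {u v : V} {d : ℕ}
    (hle : ∀ t, firings G c T v t ≤ d + firings G c T u t) :
    fireCount G c T p M v ≤ fireCount G c T p M u :=
  le_of_forall_add_mul_le (a := firings G c T v M) (b := d + firings G c T u M) fun k => by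
    rw [← h.firings_add_mul, Nat.add_assoc, ← h.firings_add_mul]
    exact hle _

theorem fireCount_eq_of_adj (h : IsSteady G c T p M) (hsafe : IsSafe G T)
    (hc : ∀ u v, G.Adj u v → 0 < c u v) {u v : V} (huv : G.Adj u v) :
    fireCount G c T p M u = fireCount G c T p M v := by
  refine le_antisymm (h.fireCount_le_fireCount (d := 1) fun t => ?_)
    (h.fireCount_le_fireCount (firings_le_add_firings hc huv))
  have := hsafe.add_firings_le hc huv t
  omega

theorem fireCount_const (h : IsSteady G c T p M) (hsafe : IsSafe G T)
    (hconn : G.toSimpleGraphInclusive.Connected) (hc : ∀ u v, G.Adj u v → 0 < c u v) (u v : V) :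
    fireCount G c T p M u = fireCount G c T p M v := by
  obtain ⟨walk⟩ := hconn.preconnected u v
  induction walk with
  | nil => rfl
  | cons hadj _ ih =>
    refine Eq.trans ?_ ih
    rcases hadj.2 with huv | hvu
    · exact h.fireCount_eq_of_adj hsafe hc huv
    · exact (h.fireCount_eq_of_adj hsafe hc hvu).symm

theorem deviation_add (h : IsSteady G c T p M) {m : ℕ} (hm : ∀ v, fireCount G c T p M v = m)
    (v : V) {t : ℕ} (ht : M ≤ t) :
    deviation G c T p m v (t + p) = deviation G c T p m v t := by
  rw [deviation, deviation, h.firings_add v ht, hm]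
  push_cast
  ring

theorem exists_tight_potential [Finite V] (h : IsSteady G c T p M) (hsafe : IsSafe G T)
    (hc : ∀ u v, G.Adj u v → 0 < c u v) (hdeg : ∀ v, ∃ u, G.Adj u v) {m : ℕ}
    (hm : ∀ v, fireCount G c T p M v = m) :
    ∃ A : V → ℤ, (∀ u v, G.Adj u v → A v ≤ A u + (p * T u v - m * c u v)) ∧
      ∀ v, ∃ u, G.Adj u v ∧ A v = A u + (p * T u v - m * c u v) := by
  obtain ⟨K, hK⟩ := exists_forall_arc_le c
  choose time htime hmin using fun v => exists_forall_le_of_eventually_periodic h.1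
    (f := deviation G c T p m v) (fun _ => h.deviation_add hm v) (M + K + 2)
  have hle : ∀ u v, G.Adj u v → deviation G c T p m v (time v)
      ≤ deviation G c T p m u (time u) + (p * T u v - m * c u v) := fun u v huv =>
    (hmin v _ (by have := htime u; omega)).trans (deviation_add_le hc huv (time u))
  refine ⟨fun v => deviation G c T p m v (time v), hle, fun v => ?_⟩
  obtain ⟨u, huv, heq⟩ := hsafe.exists_deviation_eq hc (hdeg v) (t := time v)
    (fun u => by have := htime v; have := hK u v; omega) (by have := htime v; omega) p m
  refine ⟨u, huv, (hle u v huv).antisymm ?_⟩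
  rw [heq]
  gcongr
  exact hmin u _ (by have := htime v; have := hK u v; omega)

end IsSteady

end TokenGame

theorem lemma5_general {V : Type*} [Finite V] [Nontrivial V]
    (G : Digraph V) (hconn : G.toSimpleGraphInclusive.Connected)
    (c : V → V → ℕ) (hc : ∀ u v, G.Adj u v → 0 < c u v)
    (T : V → V → ℕ) (hlive : ∀ C : TokenGame.Dicycle G, 0 < C.total T)
    (hsafe : TokenGame.IsSafe G T) :
    ∃ p m : ℕ, TokenGame.IsPeriod G c T p ∧ TokenGame.IsMultiplicity G c T p m ∧ 0 < m ∧
      IsGreatest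
        (Set.range fun C : TokenGame.Dicycle G => (C.total c : ℚ) / (C.total T : ℚ))
        ((p : ℚ) / (m : ℚ)) := by
  obtain ⟨p, hp⟩ := hsafe.exists_isPeriod hc
  obtain ⟨M, hsteady⟩ := hp.1
  obtain ⟨m, hm⟩ : ∃ m, ∀ v, TokenGame.fireCount G c T p M v = m :=
    ⟨_, fun v => hsteady.fireCount_const hsafe hconn hc v (Classical.arbitrary V)⟩
  obtain ⟨A, hle, htight⟩ := hsteady.exists_tight_potential hsafe hc (hsafe.exists_adj hconn) hm
  obtain ⟨C, hC⟩ := TokenGame.Dicycle.exists_mul_total_eq htight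
  have hm_pos : 0 < m :=
    pos_of_mul_pos_left (hC ▸ Nat.mul_pos hsteady.1 (hlive C)) (Nat.zero_le _)
  have htotal (D : TokenGame.Dicycle G) : (0 : ℚ) < D.total T := by exact_mod_cast hlive D
  have hm_posQ : (0 : ℚ) < m := by exact_mod_cast hm_pos
  refine ⟨p, m, hp, fun M' h' u => ?_, hm_pos, ⟨C, ?_⟩, ?_⟩
  · rw [h'.fireCount_eq_fireCount hsteady, hm]
  · rw [div_eq_div_iff (htotal C).ne' hm_posQ.ne', mul_comm]
    exact_mod_cast hC
  · rintro _ ⟨D, rfl⟩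
    rw [div_le_div_iff₀ (htotal D) hm_posQ, mul_comm]
    exact_mod_cast D.mul_total_le hle

theorem lemma5 {V : Type*} [Finite V] [Nontrivial V]
    (G : Digraph V) (hsymm : ∀ u v, G.Adj u v → G.Adj v u)
    (hconn : G.toSimpleGraphInclusive.Connected)
    (c : V → V → ℕ) (hc : ∀ u v, G.Adj u v → 0 < c u v)
    (T : V → V → ℕ) (hT : TokenGame.IsGood G T) :
    ∃ p m : ℕ, TokenGame.IsPeriod G c T p ∧ TokenGame.IsMultiplicity G c T p m ∧ 0 < m ∧
      IsGreatest
        (Set.range fun C : TokenGame.Dicycle G => (C.total c : ℚ) / (C.total T : ℚ))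
        ((p : ℚ) / (m : ℚ)) :=
  lemma5_general G hconn c hc T hT.1 (TokenGame.isSafe_of_symm hsymm hT.2)
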